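/- Let $H$ be a real Hilbert space with an unconditional Schauder basis $(e_k)_{k\in\mathbb N}$ (so $H$ is separable and infinite dimensional), and let $e_k^*\in H$ be the coordinate vectors, so that every $h\in H$ has the unconditionally convergent expansion $h=\sum_{k}\langle e_k^*,h\rangle e_k$ with unique coefficients. Put $E_n=\operatorname{span}\{e_1,\dots,e_n\}$. Let $K\subset H$ be a closed convex cone, and let $G^*\subset\{\theta e_k^*:\theta\in\{-1,1\},\,k\in\mathbb N\}$ be a generating system of $K$, that is, $\langle h^*,h\rangle\ge 0$ for all $h^*\in G^*$, $h\in K$, and $K=\bigcap_{h^*\in G^*}\{h\in H:\langle h^*,h\rangle\ge 0\}$. Let $D\subset G^*\times K$ be a set such that for every $(h^*,h)\in D$: (1) $\langle h^*,h\rangle=0$; (2) $(h^*,\lambda h)\in D$ for all $\lambda\ge 0$; (3) $(h^*,g)\in D$ for all $g\in K$ with $h-g\in K$. Denote by $\mathrm{Lip}_L(H)$ the set of $L$-Lipschitz functions $H\to H$; by $\mathrm F(H)$ the set of functions $H\to H$ with values in $E_n$ for some $n\in\mathbb N$; by $C_b^p(H)$ the set of $p$-times continuously (Fréchet) differentiable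 functions $f:H\to H$ such that $f$ and $Df,\dots,D^pf$ are bounded; and by $C_b^{1,1}(H)$ the set of $f\in C_b^1(H)$ such that $Df:H\to L(H)$ is Lipschitz continuous for the operator norm. A function $\sigma:H\to H$ is locally parallel if there is $\epsilon>0$ such that for all $(h^*,h)\in D$ we have $\langle h^*,\sigma(h-g)\rangle=0$ for all $g\in H$ with $\|g\|\le\epsilon$. It is weakly locally parallel if for each $(h^*,h)\in D$ there is $\epsilon=\epsilon(h^*,h)>0$ with this property. Let $\sigma\in\mathrm F(H)\cap C_b^{1,1}(H)$ be locally parallel. Then there are a constant $L\ge 0$ and a sequence $(\sigma_n)_{n\in\mathbb N}\subset\mathrm{Lip}_L(H)\cap\mathrm F(H)\cap C_b^2(H)$ such that every $\sigma_n$ is weakly locally parallel and $\sigma_n\to\sigma$ uniformly on $H$. -/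

import Mathlib

open scoped NNReal RealInnerProductSpace

namespace ConeApprox

section FunctionSpaces

variable (X Y : Type*) [NormedAddCommGroup X] [NormedSpace ℝ X]
  [NormedAddCommGroup Y] [NormedSpace ℝ Y]

/-- `Lip_L(X, Y)`: the `L`-Lipschitz functions. -/
def Lip (L : ℝ≥0) : Set (X → Y) :=
  {f | LipschitzWith L f}

/-- `C_b^p(X, Y)`: the `p`-times continuously differentiable functions that are bounded
together with their derivatives of order `1, …, p` (the derivative of order `0` is `f`). -/
def Cb (p : ℕ) : Set (X → Y) :=
  {f | ContDiff ℝ p f ∧ ∀ k ≤ p, ∃ C : ℝ, ∀ x, ‖iteratedFDeriv ℝ k f x‖ ≤ C}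

/-- `C_b^{1,1}(X, Y)`: the functions in `C_b^1(X, Y)` whose derivative is Lipschitz as a map
into the bounded linear operators with the operator norm. -/
def Cb11 : Set (X → Y) :=
  {f | f ∈ Cb X Y 1 ∧ ∃ M : ℝ≥0, LipschitzWith M (fderiv ℝ f)}

end FunctionSpaces

section Cones

variable {H : Type*} [NormedAddCommGroup H] [InnerProductSpace ℝ H] [CompleteSpace H]

/-- The vector `e_k^*` of `H` that represents the `k`-th coordinate functional of the basis. -/
noncomputable def coordVec (b : UnconditionalSchauderBasis ℕ ℝ H) (k : ℕ) : H :=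
  (InnerProductSpace.toDual ℝ H).symm (b.coord k)

/-- `E_n`: the span of the first `n` basis vectors. -/
def initialSpan (b : UnconditionalSchauderBasis ℕ ℝ H) (n : ℕ) : Submodule ℝ H :=
  Submodule.span ℝ (b.basis '' {k | k < n})

/-- `F(H)`: the functions `H → H` with values in `E_n` for some `n`. -/
def FiniteRange (b : UnconditionalSchauderBasis ℕ ℝ H) : Set (H → H) :=
  {f | ∃ n : ℕ, ∀ h, f h ∈ initialSpan b n}

/-- `G` is a generating system of the closed convex cone `K`: it is contained in the dual cone,
and `K` is the intersection of the half spaces that the elements of `G` define. -/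
structure IsGeneratingSystem (K : ProperCone ℝ H) (G : Set H) : Prop where
  subset_dual : G ⊆ (ProperCone.innerDual (K : Set H) : Set H)
  cone_eq : (K : Set H) = ⋂ g ∈ G, {h : H | 0 ≤ ⟪g, h⟫}

/-- The conditions on the set `D ⊆ G × K` of pairs `(h^*, h)`: orthogonality, stability under
nonnegative multiples of `h`, and stability under passing to smaller elements of `K` in the
order `g ≤ h ↔ h - g ∈ K`. -/
structure IsBoundaryPairSet (K : ProperCone ℝ H) (G : Set H) (D : Set (H × H)) : Prop where
  subset_prod : D ⊆ G ×ˢ (K : Set H)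
  inner_eq_zero : ∀ hs h : H, (hs, h) ∈ D → ⟪hs, h⟫ = 0
  smul_mem : ∀ hs h : H, (hs, h) ∈ D → ∀ c : ℝ, 0 ≤ c → (hs, c • h) ∈ D
  mem_of_le : ∀ hs h : H, (hs, h) ∈ D → ∀ g ∈ K, h - g ∈ K → (hs, g) ∈ D

/-- `σ` is locally parallel: one radius `ε` serves all pairs in `D`. -/
def LocallyParallel (D : Set (H × H)) (σ : H → H) : Prop :=
  ∃ ε : ℝ, 0 < ε ∧ ∀ hs h : H, (hs, h) ∈ D → ∀ g : H, ‖g‖ ≤ ε → ⟪hs, σ (h - g)⟫ = 0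

/-- `σ` is weakly locally parallel: the radius `ε` may depend on the pair in `D`. -/
def WeaklyLocallyParallel (D : Set (H × H)) (σ : H → H) : Prop :=
  ∀ hs h : H, (hs, h) ∈ D → ∃ ε : ℝ, 0 < ε ∧ ∀ g : H, ‖g‖ ≤ ε → ⟪hs, σ (h - g)⟫ = 0

end Cones

end ConeApprox

/-! The inner products in the parallelity condition are, up to sign, single coordinates of `σ`, and
`σ` has only finitely many nonzero coordinates. It therefore suffices to approximate each scalar
coordinate `f` uniformly by `C^2` functions with bounded second derivative and a common Lipschitz
constant that vanish wherever `f` does (`exists_approx`). Even the radius `ε` of `σ` is then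
preserved.

Finite-dimensional mollification is not available in `H`, so `f` is averaged over the random vector
`∑ ω_k v_k`, with independent uniform `ω_k` and `v_k` small multiples of an orthonormal basis. This
keeps the `C^{1,1}` bounds and makes each directional derivative along `v_k` a `C^1` function
(`C11With.contDiff_fderiv_noiseAverage`). The average is thus `C^2` along finite spans of the `v_k`.
Composing it with a map that is locally finite-dimensional, stays within distance 3 of the identity
and has first and second derivatives bounded uniformly (`exists_C11With_localizer`) gives a `C^2`
function on all of `H`.

For slope at most `1/4` the total error is at most 1. Composing on the left with a smooth function
of `ℝ` that vanishes on `[-1, 1]` restores the zeros of `f`. Rescaling argument and value together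
makes the error arbitrarily small without changing the order of the Lipschitz constant. -/

namespace ConeApprox

open MeasureTheory Filter Topology

/-! ### Calculus of functions with Lipschitz derivative, with explicit constants. -/

section Regularity

variable {X Y Z : Type*} [NormedAddCommGroup X] [NormedSpace ℝ X]
  [NormedAddCommGroup Y] [NormedSpace ℝ Y] [NormedAddCommGroup Z] [NormedSpace ℝ Z]

/-- Differentiable `L`-Lipschitz functions whose derivative is `M`-Lipschitz. -/
structure C11With (L M : ℝ≥0) (f : X → Y) : Prop where
  differentiable : Differentiable ℝ f
  lipschitz : LipschitzWith L f
  lipschitz_fderiv : LipschitzWith M (fderiv ℝ f)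

namespace C11With

variable {L M L' M' : ℝ≥0} {f : X → Y}

theorem norm_fderiv_le (hf : C11With L M f) (x : X) : ‖fderiv ℝ f x‖ ≤ L :=
  norm_fderiv_le_of_lipschitz ℝ hf.lipschitz

theorem contDiff_one (hf : C11With L M f) : ContDiff ℝ 1 f :=
  contDiff_one_iff_fderiv.2 ⟨hf.differentiable, hf.lipschitz_fderiv.continuous⟩

theorem mono (hf : C11With L M f) (hL : L ≤ L') (hM : M ≤ M') : C11With L' M' f :=
  ⟨hf.differentiable, hf.lipschitz.weaken hL, hf.lipschitz_fderiv.weaken hM⟩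

theorem comp {g : Y → Z} (hg : C11With L' M' g) (hf : C11With L M f) :
    C11With (L' * L) (M' * L * L + L' * M) (g ∘ f) := by
  refine ⟨hg.differentiable.comp hf.differentiable, hg.lipschitz.comp hf.lipschitz, ?_⟩
  have hd : ∀ x, fderiv ℝ (g ∘ f) x = (fderiv ℝ g (f x)).comp (fderiv ℝ f x) := fun x =>
    fderiv_comp x (hg.differentiable _) (hf.differentiable _)
  refine LipschitzWith.of_dist_le_mul fun x y => ?_
  rw [dist_eq_norm, hd, hd]
  have h1 : (fderiv ℝ g (f x)).comp (fderiv ℝ f x) - (fderiv ℝ g (f y)).comp (fderiv ℝ f y)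
      = (fderiv ℝ g (f x) - fderiv ℝ g (f y)).comp (fderiv ℝ f x)
        + (fderiv ℝ g (f y)).comp (fderiv ℝ f x - fderiv ℝ f y) := by
    ext v; simp
  have h2 : ‖fderiv ℝ g (f x) - fderiv ℝ g (f y)‖ ≤ M' * (L * dist x y) := by
    rw [← dist_eq_norm]
    exact (hg.lipschitz_fderiv.dist_le_mul _ _).trans
      (by gcongr; exact hf.lipschitz.dist_le_mul _ _)
  have h3 : ‖fderiv ℝ f x - fderiv ℝ f y‖ ≤ M * dist x y := by
    rw [← dist_eq_norm]
    exact hf.lipschitz_fderiv.dist_le_mul _ _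
  rw [h1]
  calc _ ≤ ‖fderiv ℝ g (f x) - fderiv ℝ g (f y)‖ * ‖fderiv ℝ f x‖
        + ‖fderiv ℝ g (f y)‖ * ‖fderiv ℝ f x - fderiv ℝ f y‖ :=
        (norm_add_le _ _).trans (add_le_add (ContinuousLinearMap.opNorm_comp_le _ _)
          (ContinuousLinearMap.opNorm_comp_le _ _))
    _ ≤ M' * (L * dist x y) * L + L' * (M * dist x y) := by
        gcongr
        · exact hf.norm_fderiv_le x
        · exact hg.norm_fderiv_le _
    _ = _ := by push_cast; ring

theorem of_continuousLinearMap (A : X →L[ℝ] Y) : C11With ‖A‖₊ 0 A := by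
  refine ⟨A.differentiable, A.lipschitz, ?_⟩
  have : fderiv ℝ A = fun _ => A := funext fun x => A.fderiv
  rw [this]
  exact LipschitzWith.const' A

theorem sum {ι : Type*} (s : Finset ι) {L M : ι → ℝ≥0} {f : ι → X → Y}
    (hf : ∀ i ∈ s, C11With (L i) (M i) (f i)) :
    C11With (∑ i ∈ s, L i) (∑ i ∈ s, M i) (fun x => ∑ i ∈ s, f i x) := by
  have hd : fderiv ℝ (fun x => ∑ i ∈ s, f i x) = fun x => ∑ i ∈ s, fderiv ℝ (f i) x :=
    funext fun x => fderiv_fun_sum fun i hi => (hf i hi).differentiable x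
  refine ⟨Differentiable.fun_sum fun i hi => (hf i hi).differentiable, ?_, ?_⟩
  · refine LipschitzWith.of_dist_le_mul fun x y => ?_
    push_cast
    rw [Finset.sum_mul]
    exact (dist_sum_sum_le _ _ _).trans
      (Finset.sum_le_sum fun i hi => (hf i hi).lipschitz.dist_le_mul x y)
  · rw [hd]
    refine LipschitzWith.of_dist_le_mul fun x y => ?_
    push_cast
    rw [Finset.sum_mul]
    exact (dist_sum_sum_le _ _ _).trans
      (Finset.sum_le_sum fun i hi => (hf i hi).lipschitz_fderiv.dist_le_mul x y)

/-- A bound on the directional derivatives, Lipschitz in the base point, gives `C11With`. -/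
theorem of_hasFDerivAt {f' : X → X →L[ℝ] Y} (hf : ∀ x, HasFDerivAt f (f' x) x)
    (hL : ∀ x v, ‖f' x v‖ ≤ L * ‖v‖) (hM : ∀ v, LipschitzWith (M * ‖v‖₊) fun x => f' x v) :
    C11With L M f := by
  have hd : fderiv ℝ f = f' := funext fun x => (hf x).fderiv
  refine ⟨fun x => (hf x).differentiableAt, ?_, ?_⟩
  · refine lipschitzWith_of_nnnorm_fderiv_le (𝕜 := ℝ) (fun x => (hf x).differentiableAt) fun x => ?_
    rw [hd]
    exact ContinuousLinearMap.opNorm_le_bound _ L.2 (hL x)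
  · rw [hd]
    refine LipschitzWith.of_dist_le_mul fun x y => ?_
    rw [dist_eq_norm]
    refine ContinuousLinearMap.opNorm_le_bound _ (by positivity) fun v => ?_
    have := (hM v).dist_le_mul x y
    rw [dist_eq_norm] at this
    simp only [FunLike.coe_sub, Pi.sub_apply]
    calc _ ≤ _ := this
      _ = _ := by push_cast; ring

theorem norm_iteratedFDeriv_two_le (hf : C11With L M f) (x : X) :
    ‖iteratedFDeriv ℝ 2 f x‖ ≤ M := by
  rw [← norm_iteratedFDeriv_fderiv, norm_iteratedFDeriv_one]
  exact norm_fderiv_le_of_lipschitz ℝ hf.lipschitz_fderiv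

theorem mem_Cb_two (hf : C11With L M f) (h2 : ContDiff ℝ 2 f) {B : ℝ} (hB : ∀ x, ‖f x‖ ≤ B) :
    f ∈ Cb X Y 2 := by
  refine ⟨h2, fun k hk => ?_⟩
  interval_cases k
  · exact ⟨B, fun x => by rw [norm_iteratedFDeriv_zero]; exact hB x⟩
  · exact ⟨L, fun x => by rw [norm_iteratedFDeriv_one]; exact hf.norm_fderiv_le x⟩
  · exact ⟨M, hf.norm_iteratedFDeriv_two_le⟩

/-- A sequence that is locally eventually constant has a limit with the common bounds. -/
theorem exists_of_locally_eventually_const {g : ℕ → X → Y} (hg : ∀ N, C11With L M (g N))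
    (hg2 : ∀ N, ContDiff ℝ 2 (g N))
    (hloc : ∀ x₀, ∃ N₀, ∀ᶠ x in 𝓝 x₀, ∀ N ≥ N₀, g N x = g N₀ x) :
    ∃ G : X → Y, C11With L M G ∧ ContDiff ℝ 2 G ∧ ∀ x, ∃ N₀, ∀ N ≥ N₀, G x = g N x := by
  choose N₀ hN using hloc
  let G : X → Y := fun x => g (N₀ x) x
  have hG : ∀ x, ∀ N ≥ N₀ x, G x = g N x := fun x N h => ((hN x).self_of_nhds N h).symm
  have hGe : ∀ x₀, ∀ N ≥ N₀ x₀, G =ᶠ[𝓝 x₀] g N := by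
    intro x₀ N h
    filter_upwards [hN x₀] with x hx
    rw [hG x (max N (N₀ x)) (le_max_right _ _), hx _ (h.trans (le_max_left _ _)), hx _ h]
  have hGd : ∀ x₀, ∀ N ≥ N₀ x₀, fderiv ℝ G x₀ = fderiv ℝ (g N) x₀ := fun x₀ N h =>
    (hGe x₀ N h).fderiv_eq
  refine ⟨G, ⟨fun x => ?_, fun x y => ?_, fun x y => ?_⟩, ?_, fun x => ⟨N₀ x, hG x⟩⟩
  · exact ((hg (N₀ x)).differentiable x).congr_of_eventuallyEq (hGe x _ le_rfl)
  -- Two points are compared at a common index, where the uniform bounds apply.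
  · rw [hG x _ (le_max_left _ (N₀ y)), hG y _ (le_max_right (N₀ x) _)]
    exact (hg _).lipschitz x y
  · rw [hGd x _ (le_max_left _ (N₀ y)), hGd y _ (le_max_right (N₀ x) _)]
    exact (hg _).lipschitz_fderiv x y
  · exact contDiff_iff_contDiffAt.2 fun x =>
      (hg2 (N₀ x)).contDiffAt.congr_of_eventuallyEq (hGe x _ le_rfl)

/-! ### Averages of a function over random translations. -/

section Average

variable {Ω : Type*} [MeasurableSpace Ω] {P : Measure Ω} [IsProbabilityMeasure P]
  {f : X → ℝ} {B : ℝ} {V : Ω → X}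

omit [NormedSpace ℝ X] in
theorem integrable_translate (hf : Continuous f) (hB : ∀ x, ‖f x‖ ≤ B)
    (hV : StronglyMeasurable V) (x : X) : Integrable (fun ω => f (x + V ω)) P :=
  Integrable.of_bound (hf.comp_stronglyMeasurable
    (stronglyMeasurable_const.add hV)).aestronglyMeasurable B (ae_of_all _ fun _ => hB _)

theorem integrable_fderiv_translate (hf : C11With L M f)
    (hV : StronglyMeasurable V) (x : X) : Integrable (fun ω => fderiv ℝ f (x + V ω)) P :=
  Integrable.of_bound (hf.lipschitz_fderiv.continuous.comp_stronglyMeasurable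
    (stronglyMeasurable_const.add hV)).aestronglyMeasurable L
    (ae_of_all _ fun _ => hf.norm_fderiv_le _)

theorem hasFDerivAt_average (hf : C11With L M f) (hB : ∀ x, ‖f x‖ ≤ B)
    (hV : StronglyMeasurable V) (x : X) :
    HasFDerivAt (fun x => ∫ ω, f (x + V ω) ∂P) (∫ ω, fderiv ℝ f (x + V ω) ∂P) x := by
  refine hasFDerivAt_integral_of_dominated_of_fderiv_le (bound := fun _ => (L : ℝ))
    (F' := fun x ω => fderiv ℝ f (x + V ω)) univ_mem
    (Eventually.of_forall fun x =>
      (integrable_translate hf.lipschitz.continuous hB hV x).aestronglyMeasurable)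
    (integrable_translate hf.lipschitz.continuous hB hV x)
    (hf.integrable_fderiv_translate hV x).aestronglyMeasurable
    (ae_of_all _ fun ω x _ => hf.norm_fderiv_le _) (integrable_const _)
    (ae_of_all _ fun ω x _ => ?_)
  exact (hasFDerivAt_comp_add_right (V ω)).2 (hf.differentiable (x + V ω)).hasFDerivAt

theorem average (hf : C11With L M f) (hB : ∀ x, ‖f x‖ ≤ B) (hV : StronglyMeasurable V) :
    C11With L M (fun x => ∫ ω, f (x + V ω) ∂P) := by
  have hd : fderiv ℝ (fun x => ∫ ω, f (x + V ω) ∂P) = fun x => ∫ ω, fderiv ℝ f (x + V ω) ∂P :=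
    funext fun x => (hf.hasFDerivAt_average hB hV x).fderiv
  refine ⟨fun x => (hf.hasFDerivAt_average hB hV x).differentiableAt, ?_, ?_⟩
  · refine LipschitzWith.of_dist_le_mul fun x y => ?_
    rw [dist_eq_norm, ← integral_sub (integrable_translate hf.lipschitz.continuous hB hV x)
      (integrable_translate hf.lipschitz.continuous hB hV y)]
    refine (norm_integral_le_of_norm_le_const (C := L * dist x y)
      (ae_of_all _ fun ω => ?_)).trans (by simp)
    rw [← dist_eq_norm]
    simpa using hf.lipschitz.dist_le_mul (x + V ω) (y + V ω)
  · rw [hd]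
    refine LipschitzWith.of_dist_le_mul fun x y => ?_
    rw [dist_eq_norm, ← integral_sub (hf.integrable_fderiv_translate hV x)
      (hf.integrable_fderiv_translate hV y)]
    refine (norm_integral_le_of_norm_le_const (C := M * dist x y)
      (ae_of_all _ fun ω => ?_)).trans (by simp)
    rw [← dist_eq_norm]
    simpa using hf.lipschitz_fderiv.dist_le_mul (x + V ω) (y + V ω)

omit [NormedSpace ℝ X] in
theorem norm_average_le (hB : ∀ x, ‖f x‖ ≤ B) (x : X) : ‖∫ ω, f (x + V ω) ∂P‖ ≤ B :=
  (norm_integral_le_of_norm_le_const (ae_of_all _ fun ω => hB _)).trans (by simp)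

theorem dist_average_le (hf : C11With L M f) (hB : ∀ x, ‖f x‖ ≤ B) (hV : StronglyMeasurable V)
    {R : ℝ} (hR : ∀ ω, ‖V ω‖ ≤ R) (x : X) : |∫ ω, f (x + V ω) ∂P - f x| ≤ L * R := by
  have : f x = ∫ _, f x ∂P := by simp
  rw [this, ← integral_sub (integrable_translate hf.lipschitz.continuous hB hV x)
    (integrable_const _), ← Real.norm_eq_abs]
  refine (norm_integral_le_of_norm_le_const (C := L * R) (ae_of_all _ fun ω => ?_)).trans (by simp)
  rw [← dist_eq_norm]
  refine (hf.lipschitz.dist_le_mul _ _).trans ?_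
  gcongr
  simpa using hR ω

/-- Averaging over a segment turns the derivative in its direction into a difference. -/
theorem fderiv_average_segment (hf : C11With L M f) (hB : ∀ x, ‖f x‖ ≤ B) (v x : X) :
    fderiv ℝ (fun x => ∫ t : unitInterval, f (x + (t : ℝ) • v)) x v = f (x + v) - f x := by
  have hV : StronglyMeasurable fun t : unitInterval => (t : ℝ) • v :=
    (by fun_prop : Continuous fun t : unitInterval => (t : ℝ) • v).stronglyMeasurable
  rw [(hf.hasFDerivAt_average hB hV x).fderiv,
    ContinuousLinearMap.integral_apply (hf.integrable_fderiv_translate hV x)]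
  have h1 : ∫ t : unitInterval, fderiv ℝ f (x + (t : ℝ) • v) v
      = ∫ t in Set.Icc (0 : ℝ) 1, fderiv ℝ f (x + t • v) v :=
    integral_subtype_comap (μ := (volume : Measure ℝ)) measurableSet_Icc
      (fun t : ℝ => fderiv ℝ f (x + t • v) v)
  rw [h1, integral_Icc_eq_integral_Ioc, ← intervalIntegral.integral_of_le zero_le_one,
    intervalIntegral.integral_eq_sub_of_hasDerivAt (f := fun t : ℝ => f (x + t • v))]
  · simp
  · intro t _
    have h2 : HasDerivAt (fun t : ℝ => x + t • v) v t := by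
      simpa using ((hasDerivAt_id t).smul_const v).const_add x
    exact (hf.differentiable (x + t • v)).hasFDerivAt.comp_hasDerivAt t h2
  · have := hf.lipschitz_fderiv.continuous
    exact Continuous.intervalIntegrable (by fun_prop) _ _

end Average

end C11With

end Regularity

/-! ### Averaging over infinitely many independent uniform directions. -/

section Noise

variable {X : Type*} [NormedAddCommGroup X] [NormedSpace ℝ X] [CompleteSpace X]

/-- The law of a sequence of independent uniform random variables on `[0, 1]`. -/
noncomputable abbrev uniformLaw : Measure (ℕ → unitInterval) :=
  Measure.infinitePi fun _ => (volume : Measure unitInterval)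

/-- Resampling one coordinate independently does not change a product law, as is seen on boxes. With
Fubini, this separates the `k`-th noise direction from the others. -/
theorem measurePreserving_update (k : ℕ) :
    MeasurePreserving (fun p : (ℕ → unitInterval) × unitInterval => Function.update p.1 k p.2)
      (uniformLaw.prod volume) uniformLaw := by
  have hm : Measurable
      fun p : (ℕ → unitInterval) × unitInterval => Function.update p.1 k p.2 := by
    refine measurable_pi_iff.2 fun j => ?_
    rcases eq_or_ne j k with rfl | h
    · simpa using measurable_snd
    · simpa [h, Function.comp_def] using
        (measurable_pi_apply (X := fun _ : ℕ => unitInterval) j).comp measurable_fst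
  refine ⟨hm, Measure.eq_infinitePi _ fun s t ht => ?_⟩
  rw [Measure.map_apply hm (MeasurableSet.pi s.countable_toSet fun i _ => ht i)]
  by_cases hk : k ∈ s
  · have : (fun p : (ℕ → unitInterval) × unitInterval => Function.update p.1 k p.2) ⁻¹'
        (Set.pi s t) = (Set.pi (s.erase k : Finset ℕ) t) ×ˢ t k := by
      ext ⟨ω, r⟩
      simp only [Set.mem_preimage, Set.mem_pi, Set.mem_prod, Finset.mem_coe, Finset.mem_erase]
      constructor
      · refine fun h => ⟨fun i hi => ?_, ?_⟩
        · simpa [hi.1] using h i hi.2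
        · simpa using h k hk
      · rintro ⟨h1, h2⟩ i hi
        rcases eq_or_ne i k with rfl | hik
        · simpa using h2
        · simpa [hik] using h1 i ⟨hik, hi⟩
    rw [this, Measure.prod_prod, Measure.infinitePi_pi _ fun i _ => ht i,
      Finset.prod_erase_mul _ _ hk]
  · have : (fun p : (ℕ → unitInterval) × unitInterval => Function.update p.1 k p.2) ⁻¹'
        (Set.pi s t) = (Set.pi s t) ×ˢ Set.univ := by
      ext ⟨ω, r⟩
      simp only [Set.mem_preimage, Set.mem_pi, Set.mem_prod, Finset.mem_coe, Set.mem_univ,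
        and_true]
      refine forall₂_congr fun i hi => ?_
      have : i ≠ k := fun h => hk (h ▸ hi)
      simp [this]
    rw [this, Measure.prod_prod, Measure.infinitePi_pi _ fun i _ => ht i, measure_univ, mul_one]

/-- The random vector `∑ ω_k v_k`. -/
noncomputable def noise (v : ℕ → X) (ω : ℕ → unitInterval) : X :=
  ∑' k, (ω k : ℝ) • v k

variable {v : ℕ → X}

omit [CompleteSpace X] in
theorem norm_unitInterval_smul_le (t : unitInterval) (x : X) : ‖(t : ℝ) • x‖ ≤ ‖x‖ := by
  rw [norm_smul, Real.norm_of_nonneg t.2.1]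
  exact mul_le_of_le_one_left (norm_nonneg _) t.2.2

theorem summable_noise (hv : Summable fun k => ‖v k‖) (ω : ℕ → unitInterval) :
    Summable fun k => (ω k : ℝ) • v k :=
  Summable.of_norm_bounded hv fun _ => norm_unitInterval_smul_le _ _

omit [CompleteSpace X] in
theorem norm_noise_le (hv : Summable fun k => ‖v k‖) (ω : ℕ → unitInterval) :
    ‖noise v ω‖ ≤ ∑' k, ‖v k‖ :=
  tsum_of_norm_bounded hv.hasSum fun _ => norm_unitInterval_smul_le _ _

theorem continuous_noise (hv : Summable fun k => ‖v k‖) : Continuous (noise v) :=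
  continuous_tsum (fun k => by fun_prop) hv fun _ _ => norm_unitInterval_smul_le _ _

theorem noise_update (hv : Summable fun k => ‖v k‖) (ω : ℕ → unitInterval) (k : ℕ)
    (t : unitInterval) :
    noise v (Function.update ω k t) = noise v (Function.update ω k 0) + (t : ℝ) • v k := by
  rw [← sub_eq_iff_eq_add', noise, noise,
    ← (summable_noise hv _).tsum_sub (summable_noise hv _), tsum_eq_single k]
  · simp
  · intro j hj
    simp [hj]

variable {L M : ℝ≥0} {f : X → ℝ} {B : ℝ}

/-- The average of `f` over the noise. -/
noncomputable def noiseAverage (v : ℕ → X) (f : X → ℝ) (x : X) : ℝ :=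
  ∫ ω, f (x + noise v ω) ∂uniformLaw

theorem C11With.noiseAverage (hf : C11With L M f) (hB : ∀ x, ‖f x‖ ≤ B)
    (hv : Summable fun k => ‖v k‖) : C11With L M (noiseAverage v f) :=
  hf.average hB (continuous_noise hv).stronglyMeasurable

/-- Integrating out all coordinates but the `k`-th leaves a function `g` that is still `C^{1,1}`,
and the full average is the average of `g` over the segment from `x` to `x + v k`. Its derivative
along `v k` is then `g (x + v k) - g x`, which is `C^1`. -/
theorem C11With.contDiff_fderiv_noiseAverage (hf : C11With L M f) (hB : ∀ x, ‖f x‖ ≤ B)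
    (hv : Summable fun k => ‖v k‖) (k : ℕ) :
    ContDiff ℝ 1 fun x => fderiv ℝ (ConeApprox.noiseAverage v f) x (v k) := by
  have hc : Continuous fun ω : ℕ → unitInterval => noise v (Function.update ω k 0) :=
    (continuous_noise hv).comp (continuous_id.update k continuous_const)
  let g : X → ℝ := fun x => ∫ ω, f (x + noise v (Function.update ω k 0)) ∂uniformLaw
  have hg : C11With L M g := hf.average hB hc.stronglyMeasurable
  have hgB : ∀ x, ‖g x‖ ≤ B := C11With.norm_average_le hB
  have key : ConeApprox.noiseAverage v f = fun x => ∫ t : unitInterval, g (x + (t : ℝ) • v k) := by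
    funext x
    have hfc : Continuous fun ω => f (x + noise v ω) :=
      hf.lipschitz.continuous.comp (continuous_const.add (continuous_noise hv))
    rw [ConeApprox.noiseAverage, ← (measurePreserving_update k).map_eq,
      integral_map (measurePreserving_update k).aemeasurable
        hfc.stronglyMeasurable.aestronglyMeasurable,
      integral_prod_symm]
    · refine integral_congr_ae (ae_of_all _ fun t => integral_congr_ae (ae_of_all _ fun ω => ?_))
      simp only [noise_update hv ω k t]
      congr 1
      abel
    · exact Integrable.of_bound (hfc.stronglyMeasurable.comp_measurable
        (measurePreserving_update k).measurable).aestronglyMeasurable B (ae_of_all _ fun _ => hB _)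
  rw [key]
  simp_rw [hg.fderiv_average_segment hgB (v k)]
  exact (hg.contDiff_one.comp (contDiff_id.add contDiff_const)).sub hg.contDiff_one

/-- The averaged function is twice continuously differentiable along the span of finitely many
noise directions. -/
theorem C11With.contDiff_noiseAverage_comp_sum {Z : Type*} [NormedAddCommGroup Z]
    [NormedSpace ℝ Z] (hf : C11With L M f) (hB : ∀ x, ‖f x‖ ≤ B)
    (hv : Summable fun k => ‖v k‖) (s : Finset ℕ) {ψ : ℕ → Z → ℝ} (hψ : ∀ k, ContDiff ℝ 2 (ψ k)) :
    ContDiff ℝ 2 fun z => ConeApprox.noiseAverage v f (∑ k ∈ s, ψ k z • v k) := by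
  have hF := hf.noiseAverage hB hv
  have hsum : ContDiff ℝ 2 fun z => ∑ k ∈ s, ψ k z • v k :=
    ContDiff.sum fun k _ => (hψ k).smul contDiff_const
  -- By the chain rule only the derivatives along the `v k` with `k ∈ s` enter, and those are known
  -- to be `C^1`.
  have hder : ∀ z, HasFDerivAt (fun z => ConeApprox.noiseAverage v f (∑ k ∈ s, ψ k z • v k))
      (∑ k ∈ s, fderiv ℝ (ConeApprox.noiseAverage v f) (∑ k ∈ s, ψ k z • v k) (v k) •
        fderiv ℝ (ψ k) z) z := by
    intro z
    have h1 : HasFDerivAt (fun z => ∑ k ∈ s, ψ k z • v k)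
        (∑ k ∈ s, (fderiv ℝ (ψ k) z).smulRight (v k)) z :=
      HasFDerivAt.fun_sum fun k _ =>
        (((hψ k).differentiable (by norm_num)) z).hasFDerivAt.smul_const (v k)
    refine ((hF.differentiable _).hasFDerivAt.comp z h1).congr_fderiv ?_
    ext w
    simp [map_sum, mul_comm]
  rw [show (2 : WithTop ℕ∞) = 1 + 1 by norm_num, contDiff_succ_iff_fderiv]
  refine ⟨fun z => (hder z).differentiableAt, by simp, ?_⟩
  rw [show fderiv ℝ _ = _ from funext fun z => (hder z).fderiv]
  have h1 : ∀ k, ContDiff ℝ 1 fun z =>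
      fderiv ℝ (ConeApprox.noiseAverage v f) (∑ k ∈ s, ψ k z • v k) (v k) := fun k =>
    (hf.contDiff_fderiv_noiseAverage hB hv k).comp (hsum.of_le (by norm_num))
  have h2 : ∀ k, ContDiff ℝ 1 (fderiv ℝ (ψ k)) := fun k =>
    (hψ k).fderiv_right one_add_one_eq_two.le
  exact ContDiff.sum fun k _ => (h1 k).smul (h2 k)

end Noise

/-! ### A smooth cutoff on the line. -/

section Cutoff

/-- A smooth step function from `0` on `(-∞, 1]` to `1` on `[2, ∞)`. -/
noncomputable def step (t : ℝ) : ℝ := Real.smoothTransition (t - 1)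

theorem contDiff_step {n : ℕ∞} : ContDiff ℝ n step :=
  Real.smoothTransition.contDiff.comp (contDiff_id.sub contDiff_const)

theorem step_of_le {t : ℝ} (h : t ≤ 1) : step t = 0 :=
  Real.smoothTransition.zero_of_nonpos (by linarith)

theorem step_of_ge {t : ℝ} (h : 2 ≤ t) : step t = 1 :=
  Real.smoothTransition.one_of_one_le (by linarith)

theorem step_nonneg (t : ℝ) : 0 ≤ step t := Real.smoothTransition.nonneg _

theorem step_le_one (t : ℝ) : step t ≤ 1 := Real.smoothTransition.le_one _

theorem contDiff_deriv_step {n : ℕ∞} : ContDiff ℝ n (deriv step) := by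
  have h : ContDiff ℝ ((n + 1 : ℕ∞) : WithTop ℕ∞) step := contDiff_step
  push_cast at h
  exact (contDiff_succ_iff_deriv.1 h).2.2

theorem deriv_step_of_gt {t : ℝ} (h : 2 < t) : deriv step t = 0 := by
  have : step =ᶠ[𝓝 t] fun _ => 1 := by
    filter_upwards [lt_mem_nhds h] with s hs using step_of_ge hs.le
  rw [this.deriv_eq, deriv_const]

theorem deriv_step_of_lt {t : ℝ} (h : t < 1) : deriv step t = 0 := by
  have : step =ᶠ[𝓝 t] fun _ => 0 := by
    filter_upwards [gt_mem_nhds h] with s hs using step_of_le hs.le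
  rw [this.deriv_eq, deriv_const]

theorem deriv_deriv_step_of_gt {t : ℝ} (h : 2 < t) : deriv (deriv step) t = 0 := by
  have : deriv step =ᶠ[𝓝 t] fun _ => 0 := by
    filter_upwards [lt_mem_nhds h] with s hs using deriv_step_of_gt hs
  rw [this.deriv_eq, deriv_const]

theorem deriv_deriv_step_of_lt {t : ℝ} (h : t < 1) : deriv (deriv step) t = 0 := by
  have : deriv step =ᶠ[𝓝 t] fun _ => 0 := by
    filter_upwards [gt_mem_nhds h] with s hs using deriv_step_of_lt hs
  rw [this.deriv_eq, deriv_const]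

theorem exists_deriv_step_bound :
    ∃ C : ℝ≥0, ∀ t, |deriv step t| ≤ C ∧ |deriv (deriv step) t| ≤ C := by
  have hc1 : Continuous (deriv step) := (contDiff_deriv_step (n := 0)).continuous
  have hc2 : Continuous (deriv (deriv step)) :=
    (contDiff_deriv_step (n := 1)).continuous_deriv le_rfl
  obtain ⟨C₁, h₁⟩ := (isCompact_Icc (a := (1 : ℝ)) (b := 2)).exists_bound_of_continuousOn
    hc1.continuousOn
  obtain ⟨C₂, h₂⟩ := (isCompact_Icc (a := (1 : ℝ)) (b := 2)).exists_bound_of_continuousOn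
    hc2.continuousOn
  refine ⟨(max C₁ C₂).toNNReal, fun t => ?_⟩
  rcases lt_or_ge t 1 with h | h
  · simp [deriv_step_of_lt h, deriv_deriv_step_of_lt h]
  rcases lt_or_ge 2 t with h' | h'
  · simp [deriv_step_of_gt h', deriv_deriv_step_of_gt h']
  · exact ⟨(h₁ t ⟨h, h'⟩).trans ((le_max_left _ _).trans (Real.le_coe_toNNReal _)),
      (h₂ t ⟨h, h'⟩).trans ((le_max_right _ _).trans (Real.le_coe_toNNReal _))⟩

end Cutoff

/-! ### A locally finite-dimensional perturbation of the identity. -/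

section Localizer

variable {H : Type*} [NormedAddCommGroup H] [InnerProductSpace ℝ H]

/-- The projection off the span of the first `n` vectors of `u`. -/
noncomputable def tailProj (u : ℕ → H) (n : ℕ) : H →L[ℝ] H :=
  ContinuousLinearMap.id ℝ H - ∑ k ∈ Finset.range n, (innerSL ℝ (u k)).smulRight (u k)

/-- The coefficients of the localizing map. -/
noncomputable def localCoeff (u : ℕ → H) (n : ℕ) (x : H) : ℝ :=
  step (‖tailProj u n x‖ ^ 2) * ⟪u n, x⟫

/-- Partial sums of the smooth perturbation of the identity that locally takes values in the span
of finitely many vectors of `u`. -/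
noncomputable def localizer (u : ℕ → H) (N : ℕ) (x : H) : H :=
  ∑ n ∈ Finset.range N, localCoeff u n x • u n

variable {u : ℕ → H}

theorem tailProj_apply (n : ℕ) (x : H) :
    tailProj u n x = x - ∑ k ∈ Finset.range n, ⟪u k, x⟫ • u k := by
  simp [tailProj]

theorem tailProj_succ (n : ℕ) (x : H) :
    tailProj u (n + 1) x = tailProj u n x - ⟪u n, x⟫ • u n := by
  rw [tailProj_apply, tailProj_apply, Finset.sum_range_succ]
  abel

theorem inner_tailProj (hu : Orthonormal ℝ u) (n : ℕ) (x : H) :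
    ⟪u n, tailProj u n x⟫ = ⟪u n, x⟫ := by
  rw [tailProj_apply, inner_sub_right, inner_sum, Finset.sum_eq_zero, sub_zero]
  intro k hk
  rw [inner_smul_right, hu.2 (Finset.mem_range.1 hk).ne', mul_zero]

/-- Pythagoras. The squared coefficients are the decrements of the squared tails, which is what
makes the later sums telescope. -/
theorem norm_tailProj_succ_sq (hu : Orthonormal ℝ u) (n : ℕ) (x : H) :
    ‖tailProj u (n + 1) x‖ ^ 2 = ‖tailProj u n x‖ ^ 2 - ⟪u n, x⟫ ^ 2 := by
  rw [tailProj_succ, norm_sub_sq_real, inner_smul_right, real_inner_comm (u n) (tailProj u n x),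
    inner_tailProj hu,
    norm_smul, hu.1, mul_one, Real.norm_eq_abs, sq_abs]
  ring

theorem antitone_norm_tailProj_sq (hu : Orthonormal ℝ u) (x : H) :
    Antitone fun n => ‖tailProj u n x‖ ^ 2 :=
  antitone_nat_of_succ_le fun n => by
    rw [norm_tailProj_succ_sq hu]; linarith [sq_nonneg ⟪u n, x⟫]

theorem norm_tailProj_le (hu : Orthonormal ℝ u) (n : ℕ) (x : H) : ‖tailProj u n x‖ ≤ ‖x‖ := by
  refine le_of_sq_le_sq ?_ (norm_nonneg _)
  simpa [tailProj_apply] using antitone_norm_tailProj_sq hu x (Nat.zero_le n)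

theorem norm_sum_smul_sq (hu : Orthonormal ℝ u) (s : Finset ℕ) (c : ℕ → ℝ) :
    ‖∑ n ∈ s, c n • u n‖ ^ 2 = ∑ n ∈ s, c n ^ 2 := by
  rw [← real_inner_self_eq_norm_sq, hu.inner_sum]
  simp [sq]

/-- Bessel's inequality for `v`; it handles terms in which a direction of differentiation is paired
with `u n`. -/
theorem norm_sum_smul_le_of_le_inner (hu : Orthonormal ℝ u) (s : Finset ℕ) {c : ℕ → ℝ} {A : ℝ}
    (hA : 0 ≤ A) {v : H} (hc : ∀ n, |c n| ≤ A * |⟪u n, v⟫|) :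
    ‖∑ n ∈ s, c n • u n‖ ≤ A * ‖v‖ := by
  refine abs_le_of_sq_le_sq' ?_ (by positivity) |>.2
  rw [norm_sum_smul_sq hu, mul_pow]
  calc ∑ n ∈ s, c n ^ 2 ≤ ∑ n ∈ s, A ^ 2 * ‖⟪u n, v⟫‖ ^ 2 := by
        refine Finset.sum_le_sum fun n _ => ?_
        rw [← sq_abs (c n), ← mul_pow]
        exact pow_le_pow_left₀ (abs_nonneg _) (hc n) 2
    _ ≤ A ^ 2 * ‖v‖ ^ 2 := by
        rw [← Finset.mul_sum]
        exact mul_le_mul_of_nonneg_left (hu.sum_inner_products_le v) (by positivity)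

/-- Once the squared tail is at most 2, the remaining squared coefficients telescope to at most 2,
however large `x` is. -/
theorem sum_tail_sq_le (hu : Orthonormal ℝ u) (x : H) (N : ℕ) :
    ∑ n ∈ Finset.range N, (if ‖tailProj u n x‖ ^ 2 ≤ 2 then ⟪u n, x⟫ ^ 2 else 0)
      ≤ 2 - min (‖tailProj u N x‖ ^ 2) 2 := by
  induction N with
  | zero => simp
  | succ N ih =>
    rw [Finset.sum_range_succ]
    have h := norm_tailProj_succ_sq hu N x
    have h' := sq_nonneg ⟪u N, x⟫
    split_ifs with h2
    · rw [min_eq_left h2] at ih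
      have := min_le_left (‖tailProj u (N + 1) x‖ ^ 2) 2
      linarith
    · have : min (‖tailProj u (N + 1) x‖ ^ 2) 2 ≤ min (‖tailProj u N x‖ ^ 2) 2 :=
        min_le_min_right _ (by linarith)
      linarith

/-- Counterpart of the Bessel estimate for terms that contain `⟪u n, x⟫` itself: the bound is
independent of `x` because only indices with small tail contribute. The factor 2 is a crude bound
for `√2`. -/
theorem norm_sum_smul_le_of_le_tail (hu : Orthonormal ℝ u) (N : ℕ) {c : ℕ → ℝ} {A : ℝ}
    (hA : 0 ≤ A) {x : H} (hc : ∀ n, |c n| ≤ A * |⟪u n, x⟫|)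
    (h0 : ∀ n, 2 < ‖tailProj u n x‖ ^ 2 → c n = 0) :
    ‖∑ n ∈ Finset.range N, c n • u n‖ ≤ A * 2 := by
  refine abs_le_of_sq_le_sq' ?_ (by positivity) |>.2
  rw [norm_sum_smul_sq hu, mul_pow]
  calc ∑ n ∈ Finset.range N, c n ^ 2 ≤ ∑ n ∈ Finset.range N,
        A ^ 2 * (if ‖tailProj u n x‖ ^ 2 ≤ 2 then ⟪u n, x⟫ ^ 2 else 0) := by
        refine Finset.sum_le_sum fun n _ => ?_
        split_ifs with h
        · rw [← sq_abs (c n), ← sq_abs ⟪u n, x⟫, ← mul_pow]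
          exact pow_le_pow_left₀ (abs_nonneg _) (hc n) 2
        · simp [h0 n (not_le.1 h)]
    _ ≤ A ^ 2 * 2 ^ 2 := by
        rw [← Finset.mul_sum]
        refine mul_le_mul_of_nonneg_left ((sum_tail_sq_le hu x N).trans ?_) (by positivity)
        have : 0 ≤ min (‖tailProj u N x‖ ^ 2) 2 := by positivity
        linarith

/-- The derivative of the squared norm of the tail. -/
noncomputable def tailForm (u : ℕ → H) (n : ℕ) (x : H) : H →L[ℝ] ℝ :=
  2 • (innerSL ℝ (tailProj u n x)).comp (tailProj u n)

theorem tailForm_apply (n : ℕ) (x v : H) :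
    tailForm u n x v = 2 * ⟪tailProj u n x, tailProj u n v⟫ := by
  simp [tailForm]

theorem tailForm_comm (n : ℕ) (x v : H) : tailForm u n x v = tailForm u n v x := by
  rw [tailForm_apply, tailForm_apply, real_inner_comm]

theorem hasFDerivAt_norm_tailProj_sq (n : ℕ) (x : H) :
    HasFDerivAt (fun x => ‖tailProj u n x‖ ^ 2) (tailForm u n x) x :=
  (tailProj u n).hasFDerivAt.norm_sq

theorem abs_tailForm_le (hu : Orthonormal ℝ u) (n : ℕ) (x v : H) :
    |tailForm u n x v| ≤ 2 * (‖tailProj u n x‖ * ‖v‖) := by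
  rw [tailForm_apply, abs_mul, abs_two]
  gcongr
  exact (abs_real_inner_le_norm _ _).trans
    (mul_le_mul_of_nonneg_left (norm_tailProj_le hu n v) (norm_nonneg _))

theorem abs_tailForm_le_of_le (hu : Orthonormal ℝ u) {n : ℕ} {x : H}
    (hx : ‖tailProj u n x‖ ^ 2 ≤ 2) (v : H) : |tailForm u n x v| ≤ 4 * ‖v‖ := by
  have : ‖tailProj u n x‖ ≤ 2 := by nlinarith [norm_nonneg (tailProj u n x)]
  refine (abs_tailForm_le hu n x v).trans ?_
  nlinarith [norm_nonneg v]

theorem contDiff_localCoeff (n : ℕ) : ContDiff ℝ 2 (localCoeff u n) := by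
  have h1 : ContDiff ℝ 2 fun x => step (‖tailProj u n x‖ ^ 2) :=
    (contDiff_step (n := 2)).comp ((tailProj u n).contDiff.norm_sq ℝ)
  exact h1.mul (innerSL ℝ (u n)).contDiff

/-- The derivative of `localCoeff u n` at `x` in the direction `v`. -/
noncomputable def localCoeffDeriv (u : ℕ → H) (n : ℕ) (v x : H) : ℝ :=
  step (‖tailProj u n x‖ ^ 2) * ⟪u n, v⟫
    + deriv step (‖tailProj u n x‖ ^ 2) * tailForm u n v x * ⟪u n, x⟫

theorem hasDerivAt_step (t : ℝ) : HasDerivAt step (deriv step t) t :=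
  ((contDiff_step (n := 1)).differentiable (by simp) t).hasDerivAt

theorem hasDerivAt_deriv_step (t : ℝ) : HasDerivAt (deriv step) (deriv (deriv step) t) t :=
  ((contDiff_deriv_step (n := 1)).differentiable (by simp) t).hasDerivAt

theorem hasFDerivAt_inner_left (w x : H) : HasFDerivAt (fun x : H => ⟪w, x⟫) (innerSL ℝ w) x :=
  (innerSL ℝ w).hasFDerivAt

theorem fderiv_localCoeff (n : ℕ) (x v : H) :
    fderiv ℝ (localCoeff u n) x v = localCoeffDeriv u n v x := by
  have h := (((hasDerivAt_step _).comp_hasFDerivAt x (hasFDerivAt_norm_tailProj_sq (u := u) n x)).mul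
    (hasFDerivAt_inner_left (u n) x)).fderiv
  change fderiv ℝ (localCoeff u n) x = _ at h
  rw [h, localCoeffDeriv, tailForm_comm n v x]
  simp
  ring

theorem hasFDerivAt_localCoeffDeriv (n : ℕ) (v x : H) :
    ∃ A : H →L[ℝ] ℝ, HasFDerivAt (localCoeffDeriv u n v) A x ∧ ∀ w, A w =
      deriv step (‖tailProj u n x‖ ^ 2) * tailForm u n x w * ⟪u n, v⟫
      + (deriv (deriv step) (‖tailProj u n x‖ ^ 2) * tailForm u n x w * tailForm u n x v
        + deriv step (‖tailProj u n x‖ ^ 2) * tailForm u n v w) * ⟪u n, x⟫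
      + deriv step (‖tailProj u n x‖ ^ 2) * tailForm u n x v * ⟪u n, w⟫ := by
  have hq := hasFDerivAt_norm_tailProj_sq (u := u) n x
  have h := (((hasDerivAt_step _).comp_hasFDerivAt x hq).mul_const ⟪u n, v⟫).add
    ((((hasDerivAt_deriv_step _).comp_hasFDerivAt x hq).mul (tailForm u n v).hasFDerivAt).mul
      (hasFDerivAt_inner_left (u n) x))
  refine ⟨_, h, fun w => ?_⟩
  simp [tailForm_comm n v x]
  ring

/-- Differentiation of a coefficient produces terms with `⟪u n, v⟫`, summed by Bessel, and terms
with `⟪u n, x⟫` times derivatives of `step`, which live where the squared tail is at most 2 and are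
summed by telescoping. Neither bound depends on `N`. -/
theorem exists_C11With_localizer :
    ∃ L M : ℝ≥0, ∀ {H : Type*} [NormedAddCommGroup H] [InnerProductSpace ℝ H] {u : ℕ → H},
      Orthonormal ℝ u → ∀ N, C11With L M (localizer u N) := by
  obtain ⟨C, hC⟩ := exists_deriv_step_bound
  refine ⟨1 + 8 * C, 44 * C, fun {H} _ _ {u} hu N => ?_⟩
  have hstep : ∀ (n : ℕ) (x v : H),
      |deriv step (‖tailProj u n x‖ ^ 2) * tailForm u n x v| ≤ 4 * C * ‖v‖ := by
    intro n x v
    rcases le_or_gt (‖tailProj u n x‖ ^ 2) 2 with h | h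
    · rw [abs_mul]
      calc _ ≤ C * (4 * ‖v‖) := mul_le_mul (hC _).1 (abs_tailForm_le_of_le hu h v)
            (abs_nonneg _) C.2
        _ = _ := by ring
    · rw [deriv_step_of_gt h]; simp; positivity
  have hder : ∀ x, HasFDerivAt (localizer u N)
      (∑ n ∈ Finset.range N, (fderiv ℝ (localCoeff u n) x).smulRight (u n)) x := fun x =>
    HasFDerivAt.fun_sum fun n _ =>
      (((contDiff_localCoeff n).differentiable (by norm_num)) x).hasFDerivAt.smul_const (u n)
  refine C11With.of_hasFDerivAt hder (fun x v => ?_) fun v => ?_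
  · have : (∑ n ∈ Finset.range N, (fderiv ℝ (localCoeff u n) x).smulRight (u n)) v
        = ∑ n ∈ Finset.range N, (step (‖tailProj u n x‖ ^ 2) * ⟪u n, v⟫) • u n
        + ∑ n ∈ Finset.range N,
          (deriv step (‖tailProj u n x‖ ^ 2) * tailForm u n x v * ⟪u n, x⟫) • u n := by
      rw [← Finset.sum_add_distrib]
      simp [fderiv_localCoeff, localCoeffDeriv, add_smul, tailForm_comm _ v x]
    rw [this]
    have h1 := norm_sum_smul_le_of_le_inner hu (Finset.range N) zero_le_one (v := v)
      (c := fun n => step (‖tailProj u n x‖ ^ 2) * ⟪u n, v⟫) fun n => by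
        rw [abs_mul, abs_of_nonneg (step_nonneg _)]
        exact mul_le_mul_of_nonneg_right (step_le_one _) (abs_nonneg _)
    have h2 := norm_sum_smul_le_of_le_tail hu N (A := 4 * C * ‖v‖) (by positivity) (x := x)
      (c := fun n => deriv step (‖tailProj u n x‖ ^ 2) * tailForm u n x v * ⟪u n, x⟫)
      (fun n => by
        rw [abs_mul]
        exact mul_le_mul_of_nonneg_right (hstep n x v) (abs_nonneg _))
      fun n hn => by simp [deriv_step_of_gt hn]
    refine (norm_add_le _ _).trans ((add_le_add h1 h2).trans (le_of_eq ?_))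
    push_cast; ring
  · have hv : (fun x => (∑ n ∈ Finset.range N, (fderiv ℝ (localCoeff u n) x).smulRight (u n)) v)
        = fun x => ∑ n ∈ Finset.range N, localCoeffDeriv u n v x • u n := by
      funext x
      simp [fderiv_localCoeff]
    rw [hv]
    choose A hA hAw using fun n x => hasFDerivAt_localCoeffDeriv (u := u) n v x
    have hd : ∀ x, HasFDerivAt (fun x => ∑ n ∈ Finset.range N, localCoeffDeriv u n v x • u n)
        (∑ n ∈ Finset.range N, (A n x).smulRight (u n)) x := fun x =>
      HasFDerivAt.fun_sum fun n _ => (hA n x).smul_const (u n)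
    refine lipschitzWith_of_nnnorm_fderiv_le (𝕜 := ℝ) (fun x => (hd x).differentiableAt)
      fun x => ?_
    rw [(hd x).fderiv]
    refine ContinuousLinearMap.opNorm_le_bound _ (NNReal.coe_nonneg _) fun w => ?_
    have : (∑ n ∈ Finset.range N, (A n x).smulRight (u n)) w
        = ∑ n ∈ Finset.range N,
            (deriv step (‖tailProj u n x‖ ^ 2) * tailForm u n x w * ⟪u n, v⟫) • u n
        + ∑ n ∈ Finset.range N,
            ((deriv (deriv step) (‖tailProj u n x‖ ^ 2) * tailForm u n x w * tailForm u n x v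
            + deriv step (‖tailProj u n x‖ ^ 2) * tailForm u n v w) * ⟪u n, x⟫) • u n
        + ∑ n ∈ Finset.range N,
            (deriv step (‖tailProj u n x‖ ^ 2) * tailForm u n x v * ⟪u n, w⟫) • u n := by
      rw [← Finset.sum_add_distrib, ← Finset.sum_add_distrib]
      simp [hAw, add_smul]
    rw [this]
    have h1 := norm_sum_smul_le_of_le_inner hu (Finset.range N) (A := 4 * C * ‖w‖) (by positivity)
      (c := fun n => deriv step (‖tailProj u n x‖ ^ 2) * tailForm u n x w * ⟪u n, v⟫) (v := v)
      fun n => by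
        rw [abs_mul]
        exact mul_le_mul_of_nonneg_right (hstep n x w) (abs_nonneg _)
    have h3 := norm_sum_smul_le_of_le_inner hu (Finset.range N) (A := 4 * C * ‖v‖) (by positivity)
      (c := fun n => deriv step (‖tailProj u n x‖ ^ 2) * tailForm u n x v * ⟪u n, w⟫) (v := w)
      fun n => by
        rw [abs_mul]
        exact mul_le_mul_of_nonneg_right (hstep n x v) (abs_nonneg _)
    -- Here `18 = 4 * 4 + 2`, from the product of two first-order forms and from the constant second
    -- derivative of the squared tail.
    have h2 := norm_sum_smul_le_of_le_tail hu N (A := 18 * C * ‖v‖ * ‖w‖) (by positivity) (x := x)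
      (c := fun n =>
        (deriv (deriv step) (‖tailProj u n x‖ ^ 2) * tailForm u n x w * tailForm u n x v
            + deriv step (‖tailProj u n x‖ ^ 2) * tailForm u n v w) * ⟪u n, x⟫)
      (fun n => by
        rcases le_or_gt (‖tailProj u n x‖ ^ 2) 2 with h | h
        · rw [abs_mul]
          refine mul_le_mul_of_nonneg_right ((abs_add_le _ _).trans ?_) (abs_nonneg _)
          rw [abs_mul, abs_mul, abs_mul]
          have e1 : |tailForm u n v w| ≤ 2 * (‖v‖ * ‖w‖) :=
            (abs_tailForm_le hu n v w).trans (by gcongr; exact norm_tailProj_le hu n v)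
          calc _ ≤ C * (4 * ‖w‖) * (4 * ‖v‖) + C * (2 * (‖v‖ * ‖w‖)) := by
                gcongr
                · exact (hC _).2
                · exact abs_tailForm_le_of_le hu h w
                · exact abs_tailForm_le_of_le hu h v
                · exact (hC _).1
            _ = _ := by ring
        · rw [deriv_step_of_gt h, deriv_deriv_step_of_gt h]; simp; positivity)
      fun n hn => by simp [deriv_step_of_gt hn, deriv_deriv_step_of_gt hn]
    refine (norm_add₃_le).trans ((add_le_add (add_le_add h1 h2) h3).trans (le_of_eq ?_))
    change _ = 44 * (C : ℝ) * ‖v‖ * ‖w‖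
    ring

theorem tendsto_tailProj {x : H} (hx : HasSum (fun k => ⟪u k, x⟫ • u k) x) :
    Tendsto (fun n => tailProj u n x) atTop (𝓝 0) := by
  simp_rw [tailProj_apply]
  simpa using hx.tendsto_sum_nat.const_sub x

/-- Locally only finitely many coefficients of the localizing map do not vanish. -/
theorem localizer_eventually_const (hu : Orthonormal ℝ u) {x₀ : H}
    (hx : HasSum (fun k => ⟪u k, x₀⟫ • u k) x₀) :
    ∃ N₀, ∀ᶠ x in 𝓝 x₀, ∀ N ≥ N₀, localizer u N x = localizer u N₀ x := by
  -- A squared tail below 1 at `x₀` stays below 1 nearby and for all later indices, so those cutoffs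
  -- vanish.
  have h1 : ∀ᶠ n in atTop, ‖tailProj u n x₀‖ ^ 2 < 1 := by
    have := ((tendsto_tailProj hx).norm.pow 2)
    rw [norm_zero, zero_pow two_ne_zero] at this
    exact this.eventually (gt_mem_nhds one_pos)
  obtain ⟨N₀, hN₀⟩ := h1.exists
  have hc : Continuous fun x => ‖tailProj u N₀ x‖ ^ 2 := by fun_prop
  refine ⟨N₀, ?_⟩
  filter_upwards [hc.continuousAt.eventually (gt_mem_nhds hN₀)] with x hx N hN
  refine (Finset.sum_subset (Finset.range_mono hN) fun n _ hn => ?_).symm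
  have : ‖tailProj u n x‖ ^ 2 ≤ 1 :=
    (antitone_norm_tailProj_sq hu x (by simpa using hn)).trans hx.le
  rw [localCoeff, step_of_le this, zero_mul, zero_smul]

theorem norm_localizer_sub_le (hu : Orthonormal ℝ u) {x : H}
    (hx : HasSum (fun k => ⟪u k, x⟫ • u k) x) :
    ∀ᶠ N in atTop, ‖localizer u N x - x‖ ≤ 3 := by
  have h0 := (tendsto_tailProj hx).norm
  rw [norm_zero] at h0
  filter_upwards [h0.eventually (gt_mem_nhds one_pos)] with N hN
  have h1 : localizer u N x - x
      = ∑ n ∈ Finset.range N, ((step (‖tailProj u n x‖ ^ 2) - 1) * ⟪u n, x⟫) • u n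
        - tailProj u N x := by
    rw [tailProj_apply, localizer]
    simp only [localCoeff, sub_mul, one_mul, sub_smul, Finset.sum_sub_distrib]
    abel
  -- The cutoffs differ from 1 only where the squared tail is below 2, so telescoping bounds this
  -- sum by 2; the tail left over adds at most 1.
  have h2 := norm_sum_smul_le_of_le_tail hu N zero_le_one (x := x)
    (c := fun n => (step (‖tailProj u n x‖ ^ 2) - 1) * ⟪u n, x⟫)
    (fun n => by
      rw [abs_mul]
      refine mul_le_mul_of_nonneg_right (abs_le.2 ⟨?_, ?_⟩) (abs_nonneg _)
      · linarith [step_nonneg (‖tailProj u n x‖ ^ 2)]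
      · linarith [step_le_one (‖tailProj u n x‖ ^ 2)])
    fun n hn => by simp [step_of_ge hn.le]
  rw [h1]
  refine (norm_sub_le _ _).trans ?_
  linarith

end Localizer

/-! ### Approximation of scalar functions with preservation of zeros. -/

section Approximation

variable {H : Type*} [NormedAddCommGroup H] [InnerProductSpace ℝ H] {u : ℕ → H}

theorem C11With.homothety {X : Type*} [NormedAddCommGroup X] [NormedSpace ℝ X] (r : ℝ≥0) :
    C11With r 0 fun x : X => (r : ℝ) • x := by
  refine (C11With.of_continuousLinearMap ((r : ℝ) • ContinuousLinearMap.id ℝ X)).mono ?_ le_rfl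
  refine ContinuousLinearMap.opNorm_le_bound _ r.2 fun x => ?_
  simp [norm_smul]

theorem localizer_one_smul (hu : Orthonormal ℝ u) (t : ℝ) :
    ⟪u 0, localizer u 1 (t • u 0)⟫ = step (t ^ 2) * t := by
  simp [localizer, localCoeff, tailProj_apply, inner_smul_right, norm_smul, hu.1]

/-- A smooth approximation of the identity of `ℝ` that vanishes near `0`. -/
theorem exists_C11With_step_mul (hu : Orthonormal ℝ u) :
    ∃ L M : ℝ≥0, C11With L M (fun t : ℝ => step (t ^ 2) * t) := by
  obtain ⟨L, M, h⟩ := exists_C11With_localizer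
  have h1 := (C11With.of_continuousLinearMap (innerSL ℝ (u 0))).comp
    ((h hu 1).comp (C11With.of_continuousLinearMap (ContinuousLinearMap.toSpanSingleton ℝ (u 0))))
  have h2 : innerSL ℝ (u 0) ∘ localizer u 1 ∘ ContinuousLinearMap.toSpanSingleton ℝ (u 0)
      = fun t : ℝ => step (t ^ 2) * t := by
    funext t
    simpa using localizer_one_smul hu t
  exact ⟨_, _, h2 ▸ h1⟩

theorem abs_step_mul_sub_le (t : ℝ) : |step (t ^ 2) * t - t| ≤ 2 := by
  rcases le_or_gt 2 (t ^ 2) with h | h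
  · simp [step_of_ge h]
  · have h1 : |t| ≤ 2 := abs_le_of_sq_le_sq (by linarith) (by norm_num)
    have h2 : |step (t ^ 2) - 1| ≤ 1 :=
      abs_le.2 ⟨by linarith [step_nonneg (t ^ 2)], by linarith [step_le_one (t ^ 2)]⟩
    calc |step (t ^ 2) * t - t| = |step (t ^ 2) - 1| * |t| := by rw [← abs_mul]; ring_nf
      _ ≤ 1 * 2 := mul_le_mul h2 h1 (abs_nonneg _) zero_le_one
      _ = 2 := by norm_num

/-- The slope `1/4` is chosen so that noise and localizer together cost at most 1, the size of the
interval on which `step (t ^ 2) * t` vanishes. That last composition costs another 2. The constant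
`C` depends on neither `M` nor `B`. -/
theorem exists_approx_of_lipschitz_quarter [CompleteSpace H] (hu : Orthonormal ℝ u)
    (hs : ∀ x, HasSum (fun k => ⟪u k, x⟫ • u k) x) :
    ∃ C : ℝ≥0, ∀ (f : H → ℝ) (M : ℝ≥0) (B : ℝ), C11With (1 / 4) M f → (∀ x, ‖f x‖ ≤ B) →
      ∃ (g : H → ℝ) (M' : ℝ≥0), C11With C M' g ∧ ContDiff ℝ 2 g ∧ (∀ x, |g x - f x| ≤ 3) ∧
        ∀ x, f x = 0 → g x = 0 := by
  obtain ⟨L₁, M₁, hloc⟩ := exists_C11With_localizer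
  obtain ⟨L₂, M₂, hφ⟩ := exists_C11With_step_mul hu
  refine ⟨L₂ * (1 / 4 * L₁), fun f M B hf hB => ?_⟩
  -- The weights sum to 1, so the noise has norm at most 1.
  let v : ℕ → H := fun k => ((1 : ℝ) / 2 / 2 ^ k) • u k
  have hvn : (fun k => ‖v k‖) = fun k => (1 : ℝ) / 2 / 2 ^ k := by
    funext k
    rw [norm_smul, hu.1, mul_one, Real.norm_of_nonneg (by positivity)]
  have hv : HasSum (fun k => ‖v k‖) 1 := hvn ▸ hasSum_geometric_two' 1
  have hF := hf.noiseAverage hB hv.summable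
  have hFf : ∀ x, |noiseAverage v f x - f x| ≤ 1 / 4 := fun x => by
    simpa [noiseAverage] using hf.dist_average_le (P := uniformLaw) hB
      (continuous_noise hv.summable).stronglyMeasurable
      (fun ω => (norm_noise_le hv.summable ω).trans hv.tsum_eq.le) x
  have hG2 : ∀ N, ContDiff ℝ 2 (noiseAverage v f ∘ localizer u N) := fun N => by
    have := hf.contDiff_noiseAverage_comp_sum hB hv.summable (Finset.range N)
      -- The factor undoes the weight in `v k`, so that the sum is the localizer itself.
      (ψ := fun k x => (2 * 2 ^ k) * localCoeff u k x)
      fun k => contDiff_const.mul (contDiff_localCoeff k)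
    convert this using 2 with x
    simp only [Function.comp_apply, localizer, v, smul_smul]
    refine congrArg _ (Finset.sum_congr rfl fun k _ => ?_)
    congr 1
    field_simp
  obtain ⟨G, hG, hGc, hGN⟩ := C11With.exists_of_locally_eventually_const
    (fun N => hF.comp (hloc hu N)) hG2 fun x₀ => by
      obtain ⟨N₀, h⟩ := localizer_eventually_const hu (hs x₀)
      exact ⟨N₀, h.mono fun x hx N hN => congrArg (noiseAverage v f) (hx N hN)⟩
  have hGf : ∀ x, |G x - f x| ≤ 1 := by
    intro x
    obtain ⟨N₀, hN₀⟩ := hGN x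
    obtain ⟨N, hN, hNx⟩ := ((eventually_ge_atTop N₀).and
      (norm_localizer_sub_le hu (hs x))).exists
    rw [hN₀ N hN]
    -- Slope `1/4` times displacement 3; with the `1/4` lost by averaging, the total is exactly 1.
    have h1 : |noiseAverage v f (localizer u N x) - noiseAverage v f x| ≤ 1 / 4 * 3 := by
      rw [← Real.dist_eq]
      refine (hF.lipschitz.dist_le_mul _ _).trans ?_
      rw [dist_eq_norm]
      push_cast
      gcongr
    have := abs_sub_le (noiseAverage v f (localizer u N x)) (noiseAverage v f x) (f x)
    have := hFf x
    simp only [Function.comp_apply]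
    linarith
  refine ⟨fun x => step (G x ^ 2) * G x, _, hφ.comp hG, ?_, fun x => ?_, fun x hx => ?_⟩
  · exact ((contDiff_step (n := 2)).comp (hGc.pow 2)).mul hGc
  · have := abs_sub_le (step (G x ^ 2) * G x) (G x) (f x)
    have := abs_step_mul_sub_le (G x)
    have := hGf x
    linarith
  · have h1 := hGf x
    rw [hx, sub_zero] at h1
    have : G x ^ 2 ≤ 1 := by simpa using (sq_le_one_iff_abs_le_one (G x)).2 h1
    simp [step_of_le this]

/-- Bounded `C^{1,1}` functions on a separable Hilbert space are uniform limits of `C^2` functions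
with bounded second derivatives and a common Lipschitz constant, which vanish wherever the given
function does. -/
theorem exists_approx [CompleteSpace H] (hu : Orthonormal ℝ u)
    (hs : ∀ x, HasSum (fun k => ⟪u k, x⟫ • u k) x) :
    ∃ C : ℝ≥0, ∀ (f : H → ℝ) (L M : ℝ≥0) (B : ℝ), C11With L M f → (∀ x, ‖f x‖ ≤ B) →
      ∀ r : ℝ≥0, 0 < r → ∃ (g : H → ℝ) (M' : ℝ≥0), C11With (4 * (L + 1) * C) M' g ∧
        ContDiff ℝ 2 g ∧ (∀ x, |g x - f x| ≤ 12 * (L + 1) * r) ∧ ∀ x, f x = 0 → g x = 0 := by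
  obtain ⟨C, hC⟩ := exists_approx_of_lipschitz_quarter hu hs
  refine ⟨C, fun f L M B hf hB r hr => ?_⟩
  -- The rescaled function `a⁻¹ * f (r • x)` has slope `L * r / a ≤ 1/4`; the summand 1 keeps `a`
  -- positive when `L = 0`.
  let a : ℝ≥0 := 4 * (L + 1) * r
  have ha : 0 < a := by positivity
  have ha' : (0 : ℝ) < a := ha
  have hr' : (0 : ℝ) < r := hr
  have hf1 := (C11With.homothety (X := ℝ) a⁻¹).comp (hf.comp (C11With.homothety (X := H) r))
  obtain ⟨g, M', hg, hg2, hgf, hg0⟩ := hC _ _ (a⁻¹ * B) (hf1.mono (L' := 1 / 4) (by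
      rw [← NNReal.coe_le_coe]
      push_cast
      rw [inv_mul_le_iff₀ ha']
      simp only [a]
      push_cast
      nlinarith) le_rfl) fun x => by
        simp only [Function.comp_apply, norm_smul, NNReal.norm_eq]
        push_cast
        gcongr
        exact hB _
  have e : ∀ x : H, (r : ℝ) • ((r⁻¹ : ℝ≥0) : ℝ) • x = x := fun x => by
    rw [smul_smul, NNReal.coe_inv, mul_inv_cancel₀ hr'.ne', one_smul]
  simp only [Function.comp_apply, smul_eq_mul] at hgf hg0
  refine ⟨fun x => (a : ℝ) * g (((r⁻¹ : ℝ≥0) : ℝ) • x), _,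
    ((C11With.homothety (X := ℝ) a).comp (hg.comp (C11With.homothety (X := H) r⁻¹))).mono ?_ le_rfl,
    ?_, fun x => ?_, fun x hx => ?_⟩
  -- Scaling back multiplies the slope by `a / r`, in which `r` cancels; hence the common Lipschitz
  -- constant.
  · refine le_of_eq ?_
    simp only [a]
    field_simp
  · exact contDiff_const.mul (hg2.comp (contDiff_id.const_smul ((r⁻¹ : ℝ≥0) : ℝ)))
  · have h := hgf (((r⁻¹ : ℝ≥0) : ℝ) • x)
    rw [e, NNReal.coe_inv a] at h
    calc _ = a * |g (((r⁻¹ : ℝ≥0) : ℝ) • x) - (a : ℝ)⁻¹ * f x| := by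
          rw [← abs_of_pos ha', ← abs_mul, abs_of_pos ha', mul_sub, mul_inv_cancel_left₀ ha'.ne']
      _ ≤ a * 3 := mul_le_mul_of_nonneg_left h ha'.le
      _ = _ := by simp only [a]; push_cast; ring
  · exact mul_eq_zero_of_right _ (hg0 _ (by rw [e, hx, mul_zero]))

end Approximation

/-! ### Orthonormalization and coordinates of the Schauder basis. -/

section Basis

variable {H : Type*} [NormedAddCommGroup H] [InnerProductSpace ℝ H] [CompleteSpace H]
  (b : UnconditionalSchauderBasis ℕ ℝ H)

-- Gram–Schmidt applied to the basis preserves the span, which is dense because partial expansions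
-- converge. The orthonormal system serves only to smooth the argument variable; values are still
-- expanded in the original basis.
include b in
theorem exists_orthonormal_hasSum :
    ∃ u : ℕ → H, Orthonormal ℝ u ∧ ∀ x, HasSum (fun k => ⟪u k, x⟫ • u k) x := by
  have hu := InnerProductSpace.gramSchmidtNormed_orthonormal b.linearIndependent
  have hd : ⊤ ≤ (Submodule.span ℝ
      (Set.range (InnerProductSpace.gramSchmidtNormed ℝ b.basis))).topologicalClosure := by
    intro x _
    rw [InnerProductSpace.span_gramSchmidtNormed_range, InnerProductSpace.span_gramSchmidt]
    refine mem_closure_of_tendsto (b.tendsto_proj x) (Eventually.of_forall fun A => ?_)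
    rw [GeneralSchauderBasis.proj_apply]
    exact Submodule.sum_mem _ fun i _ =>
      Submodule.smul_mem _ _ (Submodule.subset_span ⟨i, rfl⟩)
  refine ⟨_, hu, fun x => ?_⟩
  have := (HilbertBasis.mk hu hd).hasSum_repr x
  simpa [HilbertBasis.repr_apply_apply] using this

theorem inner_coordVec (k : ℕ) (x : H) : ⟪coordVec b k, x⟫ = b.coord k x := by
  rw [coordVec, InnerProductSpace.toDual_symm_apply]

omit [CompleteSpace H] in
theorem sum_coord_smul_of_mem_initialSpan {m : ℕ} {x : H} (hx : x ∈ initialSpan b m) :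
    ∑ k ∈ Finset.range m, b.coord k x • b.basis k = x := by
  rw [← GeneralSchauderBasis.proj_apply]
  refine LinearMap.eqOn_span (f := (b.proj (Finset.range m)).toLinearMap) (g := LinearMap.id)
    ?_ hx
  rintro _ ⟨k, hk, rfl⟩
  have := b.proj_apply_basis_mem (Finset.range m) k
  rw [if_pos (Finset.mem_range.2 hk)] at this
  exact this

omit [CompleteSpace H] in
theorem sum_smul_basis_mem_initialSpan (m : ℕ) (c : ℕ → ℝ) :
    ∑ k ∈ Finset.range m, c k • b.basis k ∈ initialSpan b m :=
  Submodule.sum_mem _ fun k hk =>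
    Submodule.smul_mem _ _ (Submodule.subset_span ⟨k, Finset.mem_range.1 hk, rfl⟩)

omit [CompleteSpace H] in
theorem coord_sum_smul_basis (m k : ℕ) (c : ℕ → ℝ) :
    b.coord k (∑ j ∈ Finset.range m, c j • b.basis j) = if k < m then c k else 0 := by
  simp [b.ortho, Pi.single_apply]

theorem C11With.of_mem_Cb11 {X Y : Type*} [NormedAddCommGroup X] [NormedSpace ℝ X]
    [NormedAddCommGroup Y] [NormedSpace ℝ Y] {f : X → Y} (hf : f ∈ Cb11 X Y) :
    ∃ L M : ℝ≥0, C11With L M f := by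
  obtain ⟨⟨hf1, hf2⟩, M, hM⟩ := hf
  obtain ⟨L, hL⟩ := hf2 1 le_rfl
  have hd : Differentiable ℝ f := hf1.differentiable (by simp)
  refine ⟨L.toNNReal, M, hd, lipschitzWith_of_nnnorm_fderiv_le (𝕜 := ℝ) hd fun x => ?_, hM⟩
  have := hL x
  rw [norm_iteratedFDeriv_one] at this
  exact NNReal.le_toNNReal_of_coe_le this

end Basis

end ConeApprox

/-! ### Assembly of the coordinates. -/

theorem mainTheorem8 {H : Type*} [NormedAddCommGroup H] [InnerProductSpace ℝ H]
    [CompleteSpace H]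
    (b : UnconditionalSchauderBasis ℕ ℝ H)
    (K : ProperCone ℝ H) (G : Set H)
    (hG : ConeApprox.IsGeneratingSystem K G)
    (hGb : G ⊆ {v : H | ∃ k : ℕ,
      v = ConeApprox.coordVec b k ∨ v = -ConeApprox.coordVec b k})
    (D : Set (H × H)) (hD : ConeApprox.IsBoundaryPairSet K G D)
    (σ : H → H) (hσ : σ ∈ ConeApprox.FiniteRange b ∩ ConeApprox.Cb11 H H)
    (hpar : ConeApprox.LocallyParallel D σ) :
    ∃ (L : ℝ≥0) (σn : ℕ → H → H),
      (∀ n, σn n ∈ ConeApprox.Lip H H L ∩ ConeApprox.FiniteRange b ∩ ConeApprox.Cb H H 2) ∧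
      (∀ n, ConeApprox.WeaklyLocallyParallel D (σn n)) ∧
      TendstoUniformly σn σ Filter.atTop := by
  open ConeApprox in
  obtain ⟨u, hu, hs⟩ := exists_orthonormal_hasSum b
  obtain ⟨C, hC⟩ := exists_approx hu hs
  obtain ⟨⟨m, hm⟩, hσ1⟩ := hσ
  obtain ⟨B, hB⟩ := hσ1.1.2 0 (Nat.zero_le _)
  simp only [norm_iteratedFDeriv_zero] at hB
  obtain ⟨L, M, hLM⟩ := C11With.of_mem_Cb11 hσ1
  let Λ : ℕ → ℝ≥0 := fun k => ‖b.coord k‖₊ * L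
  have hf : ∀ k, C11With (Λ k) _ (b.coord k ∘ σ) := fun k =>
    (C11With.of_continuousLinearMap (b.coord k)).comp hLM
  have hfB : ∀ k x, ‖(b.coord k ∘ σ) x‖ ≤ ‖b.coord k‖ * B := fun k x =>
    (b.coord k).le_opNorm_of_le (hB x)
  have hr : ∀ n : ℕ, 0 < (1 / (n + 1) : ℝ≥0) := fun n => by positivity
  -- Scale `1 / (n + 1)` in every coordinate: the errors tend to 0, while only the second-order
  -- constants `M'` may depend on `n`.
  choose g M' hg hg2 hgf hg0 using fun n k => hC _ _ _ _ (hf k) (hfB k) _ (hr n)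
  let σn : ℕ → H → H := fun n x => ∑ k ∈ Finset.range m, g n k x • b.basis k
  have hcl : ∀ n, C11With (∑ k ∈ Finset.range m,
      ‖ContinuousLinearMap.toSpanSingleton ℝ (b.basis k)‖₊ * (4 * (Λ k + 1) * C)) _ (σn n) :=
    fun n => C11With.sum (Finset.range m) fun k _ =>
      (C11With.of_continuousLinearMap
        (ContinuousLinearMap.toSpanSingleton ℝ (b.basis k))).comp (hg n k)
  let A : ℝ := ∑ k ∈ Finset.range m, 12 * (Λ k + 1) * ‖b.basis k‖
  have hdist : ∀ n x, ‖σn n x - σ x‖ ≤ A * (1 / ((n : ℝ) + 1)) := by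
    intro n x
    have e : σn n x - σ x
        = ∑ k ∈ Finset.range m, (g n k x - b.coord k (σ x)) • b.basis k := by
      conv_lhs => rw [← sum_coord_smul_of_mem_initialSpan b (hm x)]
      simp only [σn, sub_smul, Finset.sum_sub_distrib]
    rw [e, Finset.sum_mul]
    refine norm_sum_le_of_le _ fun k _ => ?_
    rw [norm_smul, Real.norm_eq_abs]
    have h := hgf n k x
    push_cast at h
    calc _ ≤ 12 * (Λ k + 1) * (1 / ((n : ℝ) + 1)) * ‖b.basis k‖ := by
          gcongr; exact h
      _ = _ := by ring
  refine ⟨_, σn, fun n => ⟨⟨(hcl n).lipschitz, m, fun x =>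
    sum_smul_basis_mem_initialSpan b m _⟩, ?_⟩, fun n hs h hh => ?_, ?_⟩
  · refine (hcl n).mem_Cb_two
      (ContDiff.sum fun k _ => (hg2 n k).smul contDiff_const)
      (B := A * (1 / ((n : ℝ) + 1)) + B) fun x => ?_
    have := norm_add_le (σn n x - σ x) (σ x)
    rw [sub_add_cancel] at this
    linarith [hdist n x, hB x]
  · obtain ⟨ε, hε, hp⟩ := hpar
    -- The radius of `σ` works unchanged, since zeros of each coordinate are preserved pointwise.
    refine ⟨ε, hε, fun y hy => ?_⟩
    have h0 := hp hs h hh y hy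
    have key : ∀ k, b.coord k (σ (h - y)) = 0 → b.coord k (σn n (h - y)) = 0 := by
      intro k hk
      simp only [σn]
      rw [coord_sum_smul_basis, hg0 n k _ hk, ite_self]
    obtain ⟨k, rfl | rfl⟩ := hGb (hD.subset_prod hh).1
    · rw [inner_coordVec] at h0 ⊢
      exact key k h0
    · rw [inner_neg_left, neg_eq_zero, inner_coordVec] at h0 ⊢
      exact key k h0
  · rw [Metric.tendstoUniformly_iff]
    intro ε hε
    have ht : Filter.Tendsto (fun n : ℕ => A * (1 / ((n : ℝ) + 1))) Filter.atTop (nhds 0) := by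
      simpa using tendsto_one_div_add_atTop_nhds_zero_nat.const_mul A
    filter_upwards [ht.eventually (gt_mem_nhds hε)] with n hn x
    rw [dist_comm, dist_eq_norm]
    exact (hdist n x).trans_lt hn
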